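/- Let $(\mathscr R,\mu)$ be a non-atomic measure space with $0<\mu(\mathscr R)<\infty$. For a measurable $u:\mathscr R\to[-\infty,\infty]$ let $$u^*(t)=\inf\{\lambda\ge 0:\mu(\{x\in\mathscr R:|u(x)|>\lambda\})\le t\},\qquad t\in[0,\mu(\mathscr R)),$$ be its non-increasing rearrangement. For $p\in[1,\infty)$, $q\in(p,\infty)$ and $a\in\mathbb R$ put $$\|u\|_{L^{p,p;a}}=\left(\int_0^{\mu(\mathscr R)}\Big(\log^{a}\big(\tfrac{e\mu(\mathscr R)}{s}\big)\,u^*(s)\Big)^p\,ds\right)^{1/p},\qquad \|u\|_{Y_{p,q}}=\left(\int_0^{\mu(\mathscr R)}\left(\int_0^t u^*(s)^p\,ds\right)^{q/p}\frac{dt}{t}\right)^{1/q},$$ and let $L^{p,p;a}$ and $Y_{p,q}$ be the sets of all measurable, $\mu$-a.e. finite functions for which the respective quantity is finite. For two such spaces $X,Z$ write $X\hookrightarrow Z$ if $X\subset Z$ and there is a constant $C\in(0,\infty)$ with $\|u\|_Z\le C\|u\|_X$ for every measurable $u:\mathscr R\to[-\infty,\infty]$. Let $p\in[1,\infty)$,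 $q\in(p,\infty)$ and $\alpha\in(0,\frac1q)$. Then $$L^{p,p;\frac1q}\hookrightarrow Y_{p,q}\hookrightarrow L^{p,p;\alpha},$$ and neither embedding can be reversed: $Y_{p,q}\hookrightarrow L^{p,p;\frac1q}$ fails and $L^{p,p;\alpha}\hookrightarrow Y_{p,q}$ fails. Moreover, both set inclusions $L^{p,p;\frac1q}\subset Y_{p,q}\subset L^{p,p;\alpha}$ are strict. -/

import Mathlib

open MeasureTheory Set
open scoped ENNReal NNReal

namespace LorentzBridge

variable {R : Type*} [MeasurableSpace R]

/-- A measure is non-atomic if every measurable set of positive measure has a measurable subset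
of strictly smaller positive measure. -/
def IsNonatomic (μ : Measure R) : Prop :=
  ∀ s : Set R, MeasurableSet s → 0 < μ s →
    ∃ t : Set R, t ⊆ s ∧ MeasurableSet t ∧ 0 < μ t ∧ μ t < μ s

/-- The non-increasing rearrangement
`f*(t) = inf {lam ≥ 0 : μ {x : f x > lam} ≤ t}` of a `[0,∞]`-valued function, with `inf ∅ = ∞`. -/
noncomputable def rearrangement (μ : Measure R) (f : R → ℝ≥0∞) (t : ℝ) : ℝ≥0∞ :=
  sInf {lam : ℝ≥0∞ | μ {x | lam < f x} ≤ ENNReal.ofReal t}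

/-- The Lorentz–Zygmund functional, for `0 < p, q < ∞` and `μ(R) < ∞`: the `L^q`-norm
over `(0, μ(R))` of `s ^ (1/p - 1/q) * log (e μ(R) / s) ^ a * f*(s)`. -/
noncomputable def lorentzZygmund (μ : Measure R) (p q a : ℝ) (f : R → ℝ≥0∞) : ℝ≥0∞ :=
  (∫⁻ s in Ioo (0 : ℝ) (μ.real univ),
    (ENNReal.ofReal
        (s ^ (1 / p - 1 / q) * Real.log (Real.exp 1 * μ.real univ / s) ^ a)
      * rearrangement μ f s) ^ q) ^ (1 / q)

/-- The functional of `Y_{p,q}`, for `0 < p, q < ∞`: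
`(∫_0^{μ(R)} (∫_0^t f*(s)^p ds)^{q/p} dt/t)^{1/q}`. -/
noncomputable def yNorm (μ : Measure R) (p q : ℝ) (f : R → ℝ≥0∞) : ℝ≥0∞ :=
  (∫⁻ t in Ioo (0 : ℝ) (μ.real univ),
    (∫⁻ s in Ioo (0 : ℝ) t, rearrangement μ f s ^ p) ^ (q / p) / ENNReal.ofReal t) ^ (1 / q)

/-- The space generated by a functional `ρ` on non-negative functions: all measurable
extended-real-valued functions `u`, finite almost everywhere, with `ρ(|u|) < ∞`. -/
def space (μ : Measure R) (ρ : (R → ℝ≥0∞) → ℝ≥0∞) : Set (R → EReal) :=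
  {u | Measurable u ∧ (∀ᵐ x ∂μ, (u x).abs < ∞) ∧ ρ (fun x => (u x).abs) < ∞}

/-- Continuous embedding of the space generated by `ρ` into the space generated by `σ`:
set inclusion together with the bound `σ(|u|) ≤ C ρ(|u|)` for all measurable `u`, with one
constant `0 < C < ∞`. -/
def Embeds (μ : Measure R) (ρ σ : (R → ℝ≥0∞) → ℝ≥0∞) : Prop :=
  space μ ρ ⊆ space μ σ ∧
    ∃ C : ℝ≥0, 0 < C ∧ ∀ u : R → EReal, Measurable u →
      σ (fun x => (u x).abs) ≤ (C : ℝ≥0∞) * ρ (fun x => (u x).abs)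

end LorentzBridge

namespace LorentzBridge

variable {R : Type*} [MeasurableSpace R]

/-! With g = (u*)^p, r = q/p, G(t) = ∫_0^t g and L(s) = log(eM/s), M the total mass, everything
concerns non-increasing g on (0, M): the quantity ∫ G^r dt/t is compared with ∫ L^β g, for β = 1/r
and β = αp < 1/r.

Both embeddings rest on Fubini and on L^β(s) = 1 + β ∫_s^M L^(β-1) dt/t. For β = 1/r, monotonicity
of L bounds L^(1/r) G by H = ∫ L^(1/r) g; spending r - 1 of the r powers of G on this bound leaves a
linear integral, evaluated by Fubini (`lintegral_rpow_div_le`). For β < 1/r, Hölder applied to ∫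
L^(β-1) G dt/t leaves a convergent integral of a power of L
(`exists_lintegral_logWeight_rpow_mul_le`).

Strictness is tested on step functions with jumps where L = 4^k, of sizes making G comparable to a_k
4^(-k/r) there. Since dt/t gives mass 3·4^k to the kth block, ∫ G^r dt/t behaves like ∑ a_k^r,
whereas ∫ L^(1/r) g is at least ∑ a_k. The choice a_k = 1/(k+1) separates the first pair of spaces,
a_k = 1 the second. Sierpiński's theorem makes these step functions p-th powers of rearrangements on
R. -/

/-! ### Non-atomic measures: sets of prescribed measure -/

theorem IsNonatomic.exists_subset_le_half {μ : Measure R} [IsFiniteMeasure μ]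
    (h : IsNonatomic μ) {s : Set R} (hs : MeasurableSet s) (hpos : 0 < μ.real s) :
    ∃ t ⊆ s, MeasurableSet t ∧ 0 < μ.real t ∧ μ.real t ≤ μ.real s / 2 := by
  obtain ⟨t, hts, ht, h0, h1⟩ := h s hs (ENNReal.toReal_pos_iff.1 hpos).1
  have hd := measureReal_sdiff hts ht (μ := μ)
  have h0' : 0 < μ.real t := ENNReal.toReal_pos h0.ne' (measure_ne_top μ t)
  have h1' : μ.real t < μ.real s :=
    (ENNReal.toReal_lt_toReal (measure_ne_top μ t) (measure_ne_top μ s)).2 h1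
  rcases le_total (μ.real t) (μ.real s / 2) with hle | hle
  · exact ⟨t, hts, ht, h0', hle⟩
  · exact ⟨s \ t, sdiff_subset, hs.diff ht, by linarith, by linarith⟩

theorem IsNonatomic.exists_subset_small {μ : Measure R} [IsFiniteMeasure μ]
    (h : IsNonatomic μ) {s : Set R} (hs : MeasurableSet s) (hpos : 0 < μ.real s)
    {ε : ℝ} (hε : 0 < ε) :
    ∃ t ⊆ s, MeasurableSet t ∧ 0 < μ.real t ∧ μ.real t < ε := by
  have key : ∀ n : ℕ, ∃ t ⊆ s, MeasurableSet t ∧ 0 < μ.real t ∧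
      μ.real t ≤ μ.real s * (1 / 2) ^ n := by
    intro n
    induction n with
    | zero => exact ⟨s, subset_rfl, hs, hpos, by simp⟩
    | succ n ih =>
      obtain ⟨t, hts, ht, h0, h1⟩ := ih
      obtain ⟨t', hts', ht', h0', h1'⟩ := h.exists_subset_le_half ht h0
      exact ⟨t', hts'.trans hts, ht', h0', by rw [pow_succ]; linarith⟩
  obtain ⟨n, hn⟩ := exists_pow_lt_of_lt_one (div_pos hε hpos) (by norm_num : (1 / 2 : ℝ) < 1)
  obtain ⟨t, hts, ht, h0, h1⟩ := key n
  refine ⟨t, hts, ht, h0, h1.trans_lt ?_⟩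
  rwa [lt_div_iff₀' hpos] at hn

/-- **Sierpiński's theorem**: a finite non-atomic measure takes all intermediate values. -/
theorem IsNonatomic.exists_subset_measureReal_eq {μ : Measure R} [IsFiniteMeasure μ]
    (h : IsNonatomic μ) {s : Set R} (hs : MeasurableSet s) {c : ℝ} (hc0 : 0 ≤ c)
    (hc : c ≤ μ.real s) : ∃ t ⊆ s, MeasurableSet t ∧ μ.real t = c := by
  let T := {t : Set R // t ⊆ s ∧ MeasurableSet t ∧ μ.real t ≤ c}
  -- Greedy enlargement: B' gains at least half of what any admissible superset of B could gain.
  have step : ∀ B : T, ∃ B' : T, B.1 ⊆ B'.1 ∧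
      ∀ D : T, B.1 ⊆ D.1 → μ.real D.1 + μ.real B.1 ≤ 2 * μ.real B'.1 := by
    intro B
    let V : Set ℝ := (fun D : T => μ.real D.1) '' {D | B.1 ⊆ D.1}
    have hV : BddAbove V := ⟨c, by rintro _ ⟨D, -, rfl⟩; exact D.2.2.2⟩
    have hBV : μ.real B.1 ∈ V := ⟨B, Subset.refl B.1, rfl⟩
    have hle : ∀ D : T, B.1 ⊆ D.1 → μ.real D.1 ≤ sSup V :=
      fun D hD => le_csSup hV ⟨D, hD, rfl⟩
    rcases (hle B subset_rfl).eq_or_lt with heq | hlt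
    · exact ⟨B, subset_rfl, fun D hD => by linarith [hle D hD]⟩
    · obtain ⟨_, ⟨B', hB', rfl⟩, hlt'⟩ :=
        exists_lt_of_lt_csSup ⟨_, hBV⟩ (show (sSup V + μ.real B.1) / 2 < sSup V by linarith)
      refine ⟨B', hB', fun D hD => ?_⟩
      have := hle D hD
      simp only at hlt'
      linarith
  choose next hsub hnext using step
  let B : ℕ → T := fun n => Nat.rec ⟨∅, empty_subset s, .empty, by simpa⟩ (fun _ X => next X) n
  have hmono : Monotone fun n => (B n).1 := monotone_nat_of_le_succ fun n => hsub (B n)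
  let U : Set R := ⋃ n, (B n).1
  have hlim : Filter.Tendsto (fun n => μ.real (B n).1) Filter.atTop (nhds (μ.real U)) :=
    (ENNReal.tendsto_toReal (measure_ne_top μ U)).comp (tendsto_measure_iUnion_atTop hmono)
  have hUs : U ⊆ s := iUnion_subset fun n => (B n).2.1
  have hUm : MeasurableSet U := .iUnion fun n => (B n).2.2.1
  have hUc : μ.real U ≤ c := le_of_tendsto' hlim fun n => (B n).2.2.2
  -- In the limit the greedy inequality reads μ(D) + μ(U) ≤ 2 μ(U). A maximal U of measure below c
  -- could still absorb a small piece of its complement, hence the contradiction that follows.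
  have hmax : ∀ D : T, U ⊆ D.1 → μ.real D.1 ≤ μ.real U := by
    intro D hD
    have h1 := hlim.const_add (μ.real D.1)
    have h2 := (hlim.comp (Filter.tendsto_add_atTop_nat 1)).const_mul 2
    have := le_of_tendsto_of_tendsto' h1 h2 fun n =>
      hnext (B n) D ((subset_iUnion _ n).trans hD)
    linarith
  refine ⟨U, hUs, hUm, hUc.antisymm (not_lt.1 fun hlt => ?_)⟩
  have hd := measureReal_sdiff hUs hUm (μ := μ)
  obtain ⟨D, hDs, hD, h0, h1⟩ := h.exists_subset_small (hs.diff hUm) (by linarith)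
    (sub_pos.2 hlt)
  have hUD : μ.real (U ∪ D) = μ.real U + μ.real D :=
    measureReal_union (disjoint_left.2 fun x hx hx' => (hDs hx').2 hx) hD
  have := hmax ⟨U ∪ D, union_subset hUs (hDs.trans sdiff_subset), hUm.union hD, by linarith⟩
    subset_union_left
  simp only at this
  linarith

theorem IsNonatomic.exists_antitone_seq {μ : Measure R} [IsFiniteMeasure μ]
    (h : IsNonatomic μ) {m : ℕ → ℝ} (hm : Antitone m) (hm0 : ∀ k, 0 ≤ m k)
    (hle : m 0 ≤ μ.real univ) :
    ∃ A : ℕ → Set R, Antitone A ∧ (∀ k, MeasurableSet (A k)) ∧ ∀ k, μ.real (A k) = m k := by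
  obtain ⟨A₀, -, hA₀, hA₀m⟩ := h.exists_subset_measureReal_eq .univ (hm0 0) hle
  have step : ∀ n (B : {t : Set R // MeasurableSet t ∧ μ.real t = m n}),
      ∃ B' : {t : Set R // MeasurableSet t ∧ μ.real t = m (n + 1)}, B'.1 ⊆ B.1 := by
    intro n B
    obtain ⟨t, h1, h2, h3⟩ := h.exists_subset_measureReal_eq B.2.1 (hm0 (n + 1))
      (by rw [B.2.2]; exact hm n.le_succ)
    exact ⟨⟨t, h2, h3⟩, h1⟩
  choose next hnext using step
  let B : ∀ n : ℕ, {t : Set R // MeasurableSet t ∧ μ.real t = m n} :=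
    fun n => Nat.rec ⟨A₀, hA₀, hA₀m⟩ (fun n X => next n X) n
  exact ⟨fun n => (B n).1, antitone_nat_of_succ_le fun n => hnext n (B n),
    fun n => (B n).2.1, fun n => (B n).2.2⟩

/-! ### The logarithmic weight and its integrals -/

/-- The logarithmic weight `log (e M / s)`. -/
noncomputable def logWeight (M s : ℝ) : ℝ := Real.log (Real.exp 1 * M / s)

theorem logWeight_eq {M s : ℝ} (hM : 0 < M) (hs : 0 < s) :
    logWeight M s = 1 + Real.log M - Real.log s := by
  rw [logWeight, Real.log_div (by positivity) hs.ne', Real.log_mul (by positivity) hM.ne',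
    Real.log_exp]

theorem logWeight_self {M : ℝ} (hM : 0 < M) : logWeight M M = 1 := by
  rw [logWeight_eq hM hM]; ring

theorem logWeight_anti {M s t : ℝ} (hM : 0 < M) (hs : 0 < s) (hst : s ≤ t) :
    logWeight M t ≤ logWeight M s := by
  rw [logWeight_eq hM hs, logWeight_eq hM (hs.trans_le hst)]
  linarith [Real.log_le_log hs hst]

theorem one_le_logWeight {M s : ℝ} (hs : 0 < s) (hsM : s ≤ M) : 1 ≤ logWeight M s := by
  have hM := hs.trans_le hsM
  simpa [logWeight_self hM] using logWeight_anti hM hs hsM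

theorem logWeight_pos {M s : ℝ} (hs : 0 < s) (hsM : s ≤ M) : 0 < logWeight M s :=
  one_pos.trans_le (one_le_logWeight hs hsM)

@[fun_prop]
theorem measurable_logWeight (M : ℝ) : Measurable (logWeight M) := by
  unfold logWeight; fun_prop

theorem hasDerivAt_logWeight {M s : ℝ} (hM : 0 < M) (hs : 0 < s) :
    HasDerivAt (logWeight M) (-s⁻¹) s := by
  have h := (Real.hasDerivAt_log hs.ne').const_sub (1 + Real.log M)
  refine h.congr_of_eventuallyEq ?_
  filter_upwards [lt_mem_nhds hs] with x hx using logWeight_eq hM hx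

/-- As L' = -1/t, an antiderivative is -L^b/b. -/
theorem lintegral_logWeight_rpow {M s m b : ℝ} (hs : 0 < s) (hsm : s ≤ m) (hmM : m ≤ M)
    (hb : b ≠ 0) :
    ∫⁻ t in Ioo s m, ENNReal.ofReal (logWeight M t ^ (b - 1) / t) =
      ENNReal.ofReal ((logWeight M s ^ b - logWeight M m ^ b) / b) := by
  have hM : 0 < M := hs.trans_le (hsm.trans hmM)
  have hd : ∀ x ∈ Icc s m, HasDerivAt (fun t => -(logWeight M t ^ b / b))
      (logWeight M x ^ (b - 1) / x) x := by
    intro x hx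
    have hx0 := hs.trans_le hx.1
    have h := (((hasDerivAt_logWeight hM hx0).rpow_const (p := b)
      (.inl (logWeight_pos hx0 (hx.2.trans hmM)).ne')).div_const b).neg
    exact HasDerivAt.congr_deriv h (by field_simp)
  have hnn : ∀ x ∈ Icc s m, 0 ≤ logWeight M x ^ (b - 1) / x := fun x hx =>
    div_nonneg (Real.rpow_nonneg (logWeight_pos (hs.trans_le hx.1) (hx.2.trans hmM)).le _)
      (hs.le.trans hx.1)
  have hint : IntegrableOn (fun x => logWeight M x ^ (b - 1) / x) (Ioc s m) :=
    intervalIntegral.integrableOn_deriv_of_nonneg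
      (fun x hx => (hd x hx).continuousAt.continuousWithinAt)
      (fun x hx => hd x (Ioo_subset_Icc_self hx)) fun x hx => hnn x (Ioo_subset_Icc_self hx)
  have hftc := intervalIntegral.integral_eq_sub_of_hasDerivAt
    (fun x hx => hd x (by rwa [uIcc_of_le hsm] at hx))
    ((intervalIntegrable_iff_integrableOn_Ioc_of_le hsm).2 hint)
  rw [intervalIntegral.integral_of_le hsm] at hftc
  rw [restrict_Ioo_eq_restrict_Ioc, ← ofReal_integral_eq_lintegral_ofReal hint, hftc]
  · congr 1; ring
  · filter_upwards [ae_restrict_mem measurableSet_Ioc] with x hx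
    exact hnn x (Ioc_subset_Icc_self hx)

/-- For negative b the antiderivative stays bounded near 0, so the integrals over (M/(n+1), M) are
at most -1/b uniformly in n. -/
theorem lintegral_logWeight_rpow_lt_top {M b : ℝ} (hM : 0 < M) (hb : b < 0) :
    ∫⁻ t in Ioo 0 M, ENNReal.ofReal (logWeight M t ^ (b - 1) / t) < ∞ := by
  have hU : Ioo 0 M = ⋃ n : ℕ, Ioo (M / (n + 1)) M := by
    ext x
    simp only [mem_Ioo, mem_iUnion]
    constructor
    · rintro ⟨h0, h1⟩
      obtain ⟨n, hn⟩ := exists_nat_gt (M / x)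
      refine ⟨n, ?_, h1⟩
      rw [div_lt_iff₀ (by positivity)]
      rw [div_lt_iff₀ h0] at hn
      nlinarith
    · rintro ⟨n, h0, h1⟩
      exact ⟨lt_trans (by positivity) h0, h1⟩
  have hdir : Directed (· ⊆ ·) fun n : ℕ => Ioo (M / (n + 1)) M := by
    refine (monotone_nat_of_le_succ fun n => Ioo_subset_Ioo_left ?_).directed_le
    push_cast
    gcongr
    linarith
  rw [hU, setLIntegral_iUnion_of_directed _ hdir]
  refine lt_of_le_of_lt (iSup_le fun n => ?_) (ENNReal.ofReal_lt_top (r := -1 / b))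
  have hn : M / ((n : ℝ) + 1) ≤ M := div_le_self hM.le (by linarith [n.cast_nonneg (α := ℝ)])
  have hpos : 0 < M / ((n : ℝ) + 1) := by positivity
  rw [lintegral_logWeight_rpow hpos hn le_rfl hb.ne, logWeight_self hM, Real.one_rpow]
  apply ENNReal.ofReal_le_ofReal
  have := Real.rpow_nonneg (logWeight_pos hpos hn).le b
  exact div_le_div_of_nonpos_of_le hb.le (by linarith)

/-! ### Weighted inequalities on (0, M) -/

theorem lintegral_mul_lintegral_Ioo {g w : ℝ → ℝ≥0∞} (hg : Measurable g) (hw : Measurable w)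
    (M : ℝ) :
    ∫⁻ s in Ioo 0 M, g s * ∫⁻ t in Ioo s M, w t =
      ∫⁻ t in Ioo 0 M, w t * ∫⁻ s in Ioo 0 t, g s := by
  let S : Set (ℝ × ℝ) := {x | 0 < x.1 ∧ x.1 < x.2 ∧ x.2 < M}
  have hS : MeasurableSet S := by
    refine (measurableSet_lt measurable_const measurable_fst).inter
      ((measurableSet_lt measurable_fst measurable_snd).inter
        (measurableSet_lt measurable_snd measurable_const))
  let F : ℝ → ℝ → ℝ≥0∞ := fun s t => S.indicator (fun x => g x.1 * w x.2) (s, t)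
  have hF : Measurable (Function.uncurry F) :=
    ((hg.comp measurable_fst).mul (hw.comp measurable_snd)).indicator hS
  have h := lintegral_lintegral_swap (μ := volume) (ν := volume) hF.aemeasurable
  convert h using 1
  · rw [← lintegral_indicator measurableSet_Ioo]
    refine lintegral_congr fun s => ?_
    by_cases hs : s ∈ Ioo 0 M
    · rw [indicator_of_mem hs, ← lintegral_const_mul _ hw, ← lintegral_indicator measurableSet_Ioo]
      refine lintegral_congr fun t => ?_
      simp only [F, S, indicator, mem_Ioo, mem_ofPred_eq, hs.1, true_and]
    · rw [indicator_of_notMem hs, ← lintegral_zero]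
      refine lintegral_congr fun t => (indicator_of_notMem ?_ _).symm
      rintro ⟨h1, h2, h3⟩
      exact hs ⟨h1, h2.trans h3⟩
  · rw [← lintegral_indicator measurableSet_Ioo]
    refine lintegral_congr fun t => ?_
    by_cases ht : t ∈ Ioo 0 M
    · rw [indicator_of_mem ht, ← lintegral_const_mul _ hg, ← lintegral_indicator measurableSet_Ioo]
      refine lintegral_congr fun s => ?_
      simp only [F, S, indicator, mem_Ioo, mem_ofPred_eq, ht.2, and_true, mul_comm]
    · rw [indicator_of_notMem ht, ← lintegral_zero]
      refine lintegral_congr fun s => (indicator_of_notMem ?_ _).symm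
      rintro ⟨h1, h2, h3⟩
      exact ht ⟨h1.trans h2, h3⟩

theorem measurable_lintegral_Ioo (g : ℝ → ℝ≥0∞) :
    Measurable fun t => ∫⁻ s in Ioo (0 : ℝ) t, g s :=
  Monotone.measurable fun _ _ h => lintegral_mono_set (Ioo_subset_Ioo_right h)

/-- The analytic core of the first embedding. Pointwise, G^(r-1) ≤ H^(r-1) L^(-(r-1)/r); what
remains is ∫ L^(1/r-1) G dt/t, which Fubini turns into at most r H. Monotonicity of g is not needed.
-/
theorem lintegral_rpow_div_le {M r : ℝ} (hM : 0 < M) (hr : 1 < r) {g : ℝ → ℝ≥0∞}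
    (hg : Measurable g) :
    ∫⁻ t in Ioo 0 M, (∫⁻ s in Ioo 0 t, g s) ^ r / ENNReal.ofReal t ≤
      ENNReal.ofReal r *
        (∫⁻ s in Ioo 0 M, ENNReal.ofReal (logWeight M s ^ (1 / r)) * g s) ^ r := by
  have hr0 : 0 < r := one_pos.trans hr
  set H := ∫⁻ s in Ioo 0 M, ENNReal.ofReal (logWeight M s ^ (1 / r)) * g s with hH
  let w : ℝ → ℝ≥0∞ := fun t => ENNReal.ofReal (logWeight M t ^ (1 / r - 1) / t)
  have hw : Measurable w := by fun_prop
  have hrpow : ∀ x : ℝ≥0∞, x ^ r = x ^ (r - 1) * x := fun x => by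
    conv_lhs => rw [show r = (r - 1) + 1 by ring]
    rw [ENNReal.rpow_add_of_nonneg _ _ (by linarith) zero_le_one, ENNReal.rpow_one]
  have hpt : ∀ t ∈ Ioo 0 M, (∫⁻ s in Ioo 0 t, g s) ^ r / ENNReal.ofReal t ≤
      H ^ (r - 1) * (w t * ∫⁻ s in Ioo 0 t, g s) := by
    intro t ht
    set G := ∫⁻ s in Ioo 0 t, g s with hG
    have hL := logWeight_pos ht.1 ht.2.le
    set l := ENNReal.ofReal (logWeight M t) with hl
    have hl0 : l ≠ 0 := (ENNReal.ofReal_pos.2 hL).ne'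
    have hlt : l ≠ ∞ := ENNReal.ofReal_ne_top
    -- On (0, t) the decreasing weight is at least its value at t.
    have h1 : l ^ (1 / r) * G ≤ H := by
      rw [hG, ← lintegral_const_mul _ hg, hl, ENNReal.ofReal_rpow_of_pos hL]
      refine (setLIntegral_mono (by fun_prop) fun s hs => ?_).trans
        (lintegral_mono_set (Ioo_subset_Ioo_right ht.2.le))
      gcongr
      exact logWeight_anti hM hs.1 hs.2.le
    have hwt : w t = l ^ (1 / r - 1) / ENNReal.ofReal t := by
      rw [hl, ENNReal.ofReal_rpow_of_pos hL, ← ENNReal.ofReal_div_of_pos ht.1]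
    have hcancel : (l ^ (1 / r)) ^ (r - 1) * l ^ (1 / r - 1) = 1 := by
      rw [← ENNReal.rpow_mul, ← ENNReal.rpow_add _ _ hl0 hlt,
        show 1 / r * (r - 1) + (1 / r - 1) = 0 by field_simp; ring, ENNReal.rpow_zero]
    calc G ^ r / ENNReal.ofReal t
        = ((l ^ (1 / r)) ^ (r - 1) * l ^ (1 / r - 1)) * (G ^ (r - 1) * G) / ENNReal.ofReal t := by
          rw [hcancel, one_mul, ← hrpow]
      _ = (l ^ (1 / r) * G) ^ (r - 1) * (w t * G) := by
          rw [ENNReal.mul_rpow_of_nonneg _ _ (by linarith), hwt]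
          simp only [div_eq_mul_inv]; ring
      _ ≤ H ^ (r - 1) * (w t * G) := by
          gcongr
  have hmG := measurable_lintegral_Ioo g
  calc ∫⁻ t in Ioo 0 M, (∫⁻ s in Ioo 0 t, g s) ^ r / ENNReal.ofReal t
      ≤ ∫⁻ t in Ioo 0 M, H ^ (r - 1) * (w t * ∫⁻ s in Ioo 0 t, g s) :=
        setLIntegral_mono (by fun_prop) hpt
    _ = H ^ (r - 1) * ∫⁻ s in Ioo 0 M, g s * ∫⁻ t in Ioo s M, w t := by
        rw [lintegral_const_mul _ (by fun_prop), lintegral_mul_lintegral_Ioo hg hw]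
    _ ≤ H ^ (r - 1) *
        ∫⁻ s in Ioo 0 M, ENNReal.ofReal r * (ENNReal.ofReal (logWeight M s ^ (1 / r)) * g s) := by
        refine mul_le_mul' le_rfl ?_
        refine setLIntegral_mono' measurableSet_Ioo fun s hs => ?_
        rw [lintegral_logWeight_rpow hs.1 hs.2.le le_rfl (by positivity), logWeight_self hM,
          Real.one_rpow, ← mul_assoc, ← ENNReal.ofReal_mul hr0.le, mul_comm]
        gcongr
        rw [div_div_eq_mul_div, div_one, mul_comm]
        gcongr
        linarith
    _ = ENNReal.ofReal r * H ^ r := by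
        rw [lintegral_const_mul _ (by fun_prop), ← hH, hrpow H]
        ring

theorem lintegral_logWeight_rpow_mul_eq {M β : ℝ} (hM : 0 < M) (hβ : 0 < β) {g : ℝ → ℝ≥0∞}
    (hg : Measurable g) :
    ∫⁻ s in Ioo 0 M, ENNReal.ofReal (logWeight M s ^ β) * g s =
      (∫⁻ s in Ioo 0 M, g s) + ENNReal.ofReal β *
        ∫⁻ t in Ioo 0 M, ENNReal.ofReal (logWeight M t ^ (β - 1) / t) * ∫⁻ s in Ioo 0 t, g s := by
  rw [← lintegral_mul_lintegral_Ioo hg (by fun_prop), ← lintegral_const_mul', ← lintegral_add_left hg]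
  · refine setLIntegral_congr_fun measurableSet_Ioo fun s hs => ?_
    have h1 := Real.one_le_rpow (one_le_logWeight hs.1 hs.2.le) hβ.le
    rw [lintegral_logWeight_rpow hs.1 hs.2.le le_rfl hβ.ne', logWeight_self hM, Real.one_rpow,
      mul_left_comm, ← ENNReal.ofReal_mul hβ.le, mul_div_cancel₀ _ hβ.ne', mul_comm]
    nth_rw 2 [← mul_one (g s)]
    rw [← mul_add, ← ENNReal.ofReal_one, ← ENNReal.ofReal_add zero_le_one (by linarith)]
    simp
  · exact ENNReal.ofReal_ne_top

/-- Monotonicity puts at least half of the integral on (0, M/2), and G(t) dominates that half for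
every t in (M/2, M), a set whose dt/t-measure is at least 1/2. -/
theorem lintegral_le_of_antitone {M r : ℝ} (hM : 0 < M) (hr : 0 < r) {g : ℝ → ℝ≥0∞}
    (hg : Antitone g) :
    ∫⁻ s in Ioo 0 M, g s ≤ 2 * 2 ^ (1 / r) *
      (∫⁻ t in Ioo 0 M, (∫⁻ s in Ioo 0 t, g s) ^ r / ENNReal.ofReal t) ^ (1 / r) := by
  set G := ∫⁻ s in Ioo 0 (M / 2), g s with hG
  have h1 : ∫⁻ s in Ioo 0 M, g s ≤ 2 * G := by
    have hsub : Ioo 0 M ⊆ Ioo 0 (M / 2) ∪ Ico (M / 2) M := fun x hx => by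
      rcases lt_or_ge x (M / 2) with h | h
      exacts [.inl ⟨hx.1, h⟩, .inr ⟨h, hx.2⟩]
    refine ((lintegral_mono_set hsub).trans (lintegral_union_le _ _ _)).trans ?_
    rw [two_mul]
    refine add_le_add le_rfl ?_
    calc ∫⁻ s in Ico (M / 2) M, g s ≤ ∫⁻ _ in Ico (M / 2) M, g (M / 2) :=
          setLIntegral_mono measurable_const fun s hs => hg hs.1
      _ = ∫⁻ _ in Ioo 0 (M / 2), g (M / 2) := by
          simp only [setLIntegral_const, Real.volume_Ico, Real.volume_Ioo]
          congr 2; ring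
      _ ≤ G := setLIntegral_mono hg.measurable fun s hs => hg hs.2.le
  have hmG := measurable_lintegral_Ioo g
  have h2 : G ^ r / 2 ≤ ∫⁻ t in Ioo 0 M, (∫⁻ s in Ioo 0 t, g s) ^ r / ENNReal.ofReal t := by
    calc G ^ r / 2 = ∫⁻ _ in Ioo (M / 2) M, G ^ r / ENNReal.ofReal M := by
          rw [setLIntegral_const, Real.volume_Ioo, sub_half, ENNReal.ofReal_div_of_pos two_pos]
          have h0 : ENNReal.ofReal M ≠ 0 := (ENNReal.ofReal_pos.2 hM).ne'
          simp only [div_eq_mul_inv, ENNReal.ofReal_ofNat]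
          rw [mul_assoc, ← mul_assoc _ (ENNReal.ofReal M),
            ENNReal.inv_mul_cancel h0 ENNReal.ofReal_ne_top, one_mul]
      _ ≤ ∫⁻ t in Ioo (M / 2) M, (∫⁻ s in Ioo 0 t, g s) ^ r / ENNReal.ofReal t := by
          refine setLIntegral_mono (by fun_prop) fun t ht => ?_
          gcongr
          · exact lintegral_mono_set (Ioo_subset_Ioo_right ht.1.le)
          · exact ht.2.le
      _ ≤ _ := lintegral_mono_set (Ioo_subset_Ioo_left (by positivity))
  refine h1.trans ?_
  rw [mul_assoc]
  gcongr
  rw [← ENNReal.mul_rpow_of_nonneg _ _ (by positivity), one_div, ENNReal.le_rpow_inv_iff hr]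
  rw [mul_comm]
  exact (ENNReal.div_le_iff two_ne_zero ENNReal.ofNat_ne_top).1 h2

/-- The analytic core of the second embedding: Fubini splits off ∫ g, controlled by monotonicity,
and Hölder with respect to dt/t handles ∫ L^(β-1) G dt/t. -/
theorem exists_lintegral_logWeight_rpow_mul_le {M r β : ℝ} (hM : 0 < M) (hr : 1 < r) (hβ : 0 < β)
    (hβr : β < 1 / r) :
    ∃ C : ℝ≥0∞, C ≠ ∞ ∧ ∀ g : ℝ → ℝ≥0∞, Antitone g →
      ∫⁻ s in Ioo 0 M, ENNReal.ofReal (logWeight M s ^ β) * g s ≤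
        C * (∫⁻ t in Ioo 0 M, (∫⁻ s in Ioo 0 t, g s) ^ r / ENNReal.ofReal t) ^ (1 / r) := by
  have hr0 : 0 < r := one_pos.trans hr
  obtain ⟨r', hrr'⟩ : ∃ r', r.HolderConjugate r' := ⟨_, Real.HolderConjugate.conjExponent hr⟩
  have hr'0 : 0 < r' := hrr'.symm.pos
  -- Convergence of ∫ L^((β-1)r') dt/t at 0; this is where β < 1/r enters.
  have hb : (β - 1) * r' + 1 < 0 := by
    have h1 := hrr'.inv_add_inv_eq_one
    have h2 : (β - 1) * r' < -(r'⁻¹) * r' := by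
      refine mul_lt_mul_of_pos_right ?_ hr'0
      rw [one_div] at hβr
      linarith
    rw [neg_mul, inv_mul_cancel₀ hr'0.ne'] at h2
    linarith
  have hD := lintegral_logWeight_rpow_lt_top hM hb
  rw [add_sub_cancel_right] at hD
  set D := ∫⁻ t in Ioo 0 M, ENNReal.ofReal (logWeight M t ^ ((β - 1) * r') / t)
  refine ⟨2 * 2 ^ (1 / r) + ENNReal.ofReal β * D ^ (1 / r'), ?_, fun g hg => ?_⟩
  · refine ENNReal.add_ne_top.2 ⟨ENNReal.mul_ne_top ENNReal.ofNat_ne_top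
      (ENNReal.rpow_ne_top_of_nonneg (by positivity) ENNReal.ofNat_ne_top),
      ENNReal.mul_ne_top ENNReal.ofReal_ne_top
        (ENNReal.rpow_ne_top_of_nonneg (by positivity) hD.ne)⟩
  have hmG := measurable_lintegral_Ioo g
  rw [lintegral_logWeight_rpow_mul_eq hM hβ hg.measurable, add_mul]
  gcongr ?_ + ?_
  · exact lintegral_le_of_antitone hM hr0 hg
  rw [mul_assoc]
  gcongr
  -- The density 1/t is shared between the two Hölder factors as t^(-1/r) t^(-1/r').
  let f₁ : ℝ → ℝ≥0∞ := fun t => (∫⁻ s in Ioo 0 t, g s) * ENNReal.ofReal t ^ (-(1 / r))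
  let f₂ : ℝ → ℝ≥0∞ := fun t => ENNReal.ofReal (logWeight M t ^ (β - 1)) *
    ENNReal.ofReal t ^ (-(1 / r'))
  have hf₁ : Measurable f₁ := by fun_prop
  have hf₂ : Measurable f₂ := by fun_prop
  calc ∫⁻ t in Ioo 0 M, ENNReal.ofReal (logWeight M t ^ (β - 1) / t) * ∫⁻ s in Ioo 0 t, g s
      = ∫⁻ t in Ioo 0 M, (f₂ * f₁) t := by
        refine setLIntegral_congr_fun measurableSet_Ioo fun t ht => ?_
        have h0 : ENNReal.ofReal t ≠ 0 := (ENNReal.ofReal_pos.2 ht.1).ne'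
        have h1 : ENNReal.ofReal t ^ (-(1 / r')) * ENNReal.ofReal t ^ (-(1 / r)) =
            (ENNReal.ofReal t)⁻¹ := by
          rw [← ENNReal.rpow_add _ _ h0 ENNReal.ofReal_ne_top, ← ENNReal.rpow_neg_one]
          congr 1
          have := hrr'.inv_add_inv_eq_one
          simp only [one_div]
          linarith
        simp only [f₁, f₂, Pi.mul_apply]
        rw [ENNReal.ofReal_div_of_pos ht.1, div_eq_mul_inv, ← h1]
        ring
    _ ≤ (∫⁻ t in Ioo 0 M, f₂ t ^ r') ^ (1 / r') * (∫⁻ t in Ioo 0 M, f₁ t ^ r) ^ (1 / r) :=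
        ENNReal.lintegral_mul_le_Lp_mul_Lq _ hrr'.symm hf₂.aemeasurable hf₁.aemeasurable
    _ = _ := by
        congr 2
        · refine setLIntegral_congr_fun measurableSet_Ioo fun t ht => ?_
          have hL := logWeight_pos ht.1 ht.2.le
          simp only [f₂]
          rw [ENNReal.mul_rpow_of_nonneg _ _ hr'0.le,
            ENNReal.ofReal_rpow_of_nonneg (by positivity) hr'0.le, ← Real.rpow_mul hL.le,
            ← ENNReal.rpow_mul, neg_mul, one_div_mul_cancel hr'0.ne', ENNReal.rpow_neg_one,
            ENNReal.ofReal_div_of_pos ht.1, div_eq_mul_inv]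
        · refine setLIntegral_congr_fun measurableSet_Ioo fun t ht => ?_
          simp only [f₁]
          rw [ENNReal.mul_rpow_of_nonneg _ _ hr0.le, ← ENNReal.rpow_mul, neg_mul,
            one_div_mul_cancel hr0.ne', ENNReal.rpow_neg_one, div_eq_mul_inv]

/-! ### Rearrangements and the two embeddings -/

theorem rearrangement_antitone (μ : Measure R) (f : R → ℝ≥0∞) :
    Antitone (rearrangement μ f) := fun _ _ h =>
  sInf_le_sInf fun _ hl => le_trans hl (ENNReal.ofReal_le_ofReal h)

theorem rearrangement_rpow_antitone (μ : Measure R) (f : R → ℝ≥0∞) {p : ℝ} (hp : 0 ≤ p) :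
    Antitone fun s => rearrangement μ f s ^ p := fun _ _ h =>
  ENNReal.rpow_le_rpow (rearrangement_antitone μ f h) hp

theorem lorentzZygmund_self_eq (μ : Measure R) {p : ℝ} (hp : 0 < p) (a : ℝ) (f : R → ℝ≥0∞) :
    lorentzZygmund μ p p a f =
      (∫⁻ s in Ioo 0 (μ.real univ), ENNReal.ofReal (logWeight (μ.real univ) s ^ (a * p)) *
        rearrangement μ f s ^ p) ^ (1 / p) := by
  unfold lorentzZygmund
  congr 1
  refine setLIntegral_congr_fun measurableSet_Ioo fun s hs => ?_
  have hL := logWeight_pos hs.1 hs.2.le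
  rw [logWeight] at *
  rw [sub_self, Real.rpow_zero, one_mul, ENNReal.mul_rpow_of_nonneg _ _ hp.le,
    ENNReal.ofReal_rpow_of_nonneg (by positivity) hp.le, ← Real.rpow_mul hL.le]

theorem Embeds.of_bound {μ : Measure R} {ρ σ : (R → ℝ≥0∞) → ℝ≥0∞} {C : ℝ≥0∞} (hC : C ≠ ∞)
    (h : ∀ f, σ f ≤ C * ρ f) : Embeds μ ρ σ := by
  refine ⟨fun u hu => ⟨hu.1, hu.2.1, (h _).trans_lt (ENNReal.mul_lt_top hC.lt_top hu.2.2)⟩,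
    -- Adding 1 keeps the constant positive even when C = 0.
    C.toNNReal + 1, by positivity, fun u _ => (h _).trans ?_⟩
  gcongr
  push_cast
  rw [ENNReal.coe_toNNReal hC]
  exact le_self_add

theorem embeds_lorentzZygmund_yNorm (μ : Measure R) (hM : 0 < μ.real univ) {p q : ℝ}
    (hp : 0 < p) (hpq : p < q) :
    Embeds μ (lorentzZygmund μ p p (1 / q)) (yNorm μ p q) := by
  have hq : 0 < q := hp.trans hpq
  have hr : 1 < q / p := (one_lt_div hp).2 hpq
  refine Embeds.of_bound (C := ENNReal.ofReal (q / p) ^ (1 / q))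
    (ENNReal.rpow_ne_top_of_nonneg (by positivity) ENNReal.ofReal_ne_top) fun f => ?_
  have h := lintegral_rpow_div_le hM hr (rearrangement_rpow_antitone μ f hp.le).measurable
  rw [lorentzZygmund_self_eq μ hp, yNorm]
  refine (ENNReal.rpow_le_rpow h (by positivity)).trans_eq ?_
  rw [ENNReal.mul_rpow_of_nonneg _ _ (by positivity), ← ENNReal.rpow_mul,
    show q / p * (1 / q) = 1 / p by field_simp, one_div_div, one_div_mul_eq_div]

theorem embeds_yNorm_lorentzZygmund (μ : Measure R) (hM : 0 < μ.real univ) {p q α : ℝ}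
    (hp : 0 < p) (hpq : p < q) (hα : 0 < α) (hαq : α < 1 / q) :
    Embeds μ (yNorm μ p q) (lorentzZygmund μ p p α) := by
  have hq : 0 < q := hp.trans hpq
  have hr : 1 < q / p := (one_lt_div hp).2 hpq
  have hβ : α * p < 1 / (q / p) := by
    rw [one_div_div, ← one_div_mul_eq_div]
    gcongr
  obtain ⟨C, hC, h⟩ := exists_lintegral_logWeight_rpow_mul_le hM hr (mul_pos hα hp) hβ
  refine Embeds.of_bound (C := C ^ (1 / p)) (ENNReal.rpow_ne_top_of_nonneg (by positivity) hC)
    fun f => ?_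
  rw [lorentzZygmund_self_eq μ hp, yNorm]
  refine (ENNReal.rpow_le_rpow (h _ (rearrangement_rpow_antitone μ f hp.le))
    (by positivity)).trans_eq ?_
  rw [ENNReal.mul_rpow_of_nonneg _ _ (by positivity), ← ENNReal.rpow_mul,
    show 1 / (q / p) * (1 / p) = 1 / q by field_simp]

/-! ### Step functions as powers of rearrangements -/

/-- The non-increasing step function with jumps `c k` at the points `m k`. -/
noncomputable def stepSum (c : ℕ → ℝ≥0∞) (m : ℕ → ℝ) (t : ℝ) : ℝ≥0∞ :=
  ∑' k, (Iio (m k)).indicator (fun _ => c k) t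

theorem measurable_stepSum (c : ℕ → ℝ≥0∞) (m : ℕ → ℝ) : Measurable (stepSum c m) :=
  Measurable.tsum fun _ => measurable_const.indicator measurableSet_Iio

/-- Induction on partial sums. If t < m n, a level below the sum up to n would be exceeded on all of
A n, whose measure is more than t; otherwise the nth term vanishes at t. -/
theorem stepSum_le_of_measure_le {μ : Measure R} [IsFiniteMeasure μ] {c : ℕ → ℝ≥0∞} {m : ℕ → ℝ}
    {A : ℕ → Set R} (hA : Antitone A) (hAm : ∀ k, μ.real (A k) = m k) {t : ℝ} (ht : 0 < t)
    {l : ℝ≥0∞} (hl : μ {x | l < ∑' k, (A k).indicator (fun _ => c k) x} ≤ ENNReal.ofReal t) :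
    stepSum c m t ≤ l := by
  refine ENNReal.tsum_le_of_sum_range_le fun n => ?_
  induction n with
  | zero => simp
  | succ n ih =>
    rcases lt_or_ge t (m n) with h | h
    · by_contra! hlt
      have hsub : A n ⊆ {x | l < ∑' k, (A k).indicator (fun _ => c k) x} := fun x hx => by
        refine hlt.trans_le (le_trans (Finset.sum_le_sum fun k hk => ?_)
          (ENNReal.sum_le_tsum (Finset.range (n + 1))))
        rw [indicator_of_mem (hA (Finset.mem_range_succ_iff.1 hk) hx)]
        exact indicator_le_self' (fun _ _ => zero_le) _
      have h1 := (measure_mono hsub).trans hl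
      rw [← ofReal_measureReal, hAm] at h1
      exact h.not_ge ((ENNReal.ofReal_le_ofReal_iff ht.le).1 h1)
    · rw [Finset.sum_range_succ, indicator_of_notMem (by simpa using h), add_zero]
      exact ih

theorem measure_stepSum_lt_le {μ : Measure R} [IsFiniteMeasure μ] (c : ℕ → ℝ≥0∞) {m : ℕ → ℝ}
    (hm0 : Filter.Tendsto m Filter.atTop (nhds 0)) {A : ℕ → Set R} (hA : Antitone A)
    (hAm : ∀ k, μ.real (A k) = m k) {t : ℝ} (ht : 0 < t) :
    μ {x | stepSum c m t < ∑' k, (A k).indicator (fun _ => c k) x} ≤ ENNReal.ofReal t := by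
  classical
  have hex : ∃ n, m n ≤ t := ((hm0.eventually (gt_mem_nhds ht)).mono fun _ h => le_of_lt h).exists
  -- For the first n with m n ≤ t, a point outside A n lies only in sets A k with k < n, and each
  -- such term is present in the step function at t.
  have hsub : {x | stepSum c m t < ∑' k, (A k).indicator (fun _ => c k) x} ⊆
      A (Nat.find hex) := fun x hx => by
    by_contra hxA
    refine (mem_ofPred_eq ▸ hx : stepSum c m t < _).not_ge (ENNReal.tsum_le_tsum fun k => ?_)
    by_cases hk : x ∈ A k
    · have hkN : k < Nat.find hex := by
        by_contra! hle
        exact hxA (hA hle hk)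
      rw [indicator_of_mem hk, indicator_of_mem]
      exact not_le.1 (Nat.find_min hex hkN)
    · rw [indicator_of_notMem hk]
      exact zero_le
  refine (measure_mono hsub).trans ?_
  rw [← ofReal_measureReal, hAm]
  exact ENNReal.ofReal_le_ofReal (Nat.find_spec hex)

theorem rearrangement_rpow_one_div {μ : Measure R} {F : R → ℝ≥0∞} {p t : ℝ} (hp : 0 < p)
    {y : ℝ≥0∞} (h1 : μ {x | y < F x} ≤ ENNReal.ofReal t)
    (h2 : ∀ l, μ {x | l < F x} ≤ ENNReal.ofReal t → y ≤ l) :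
    rearrangement μ (fun x => F x ^ (1 / p)) t ^ p = y := by
  have key : rearrangement μ (fun x => F x ^ (1 / p)) t = y ^ (1 / p) := by
    refine le_antisymm (sInf_le ?_) (le_sInf fun l hl => ?_)
    · refine (measure_mono fun x hx => ?_).trans h1
      exact (ENNReal.rpow_lt_rpow_iff (by positivity)).1 hx
    · rw [one_div, ENNReal.rpow_inv_le_iff hp]
      refine h2 _ ((measure_mono fun x hx => ?_).trans hl)
      rw [mem_ofPred_eq] at hx ⊢
      rwa [one_div, ENNReal.lt_rpow_inv_iff hp]
  rw [key, ← ENNReal.rpow_mul, one_div_mul_cancel hp.ne', ENNReal.rpow_one]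

theorem abs_coe_ennreal (x : ℝ≥0∞) : (x : EReal).abs = x := by
  induction x with
  | top => rfl
  | coe x =>
    change ((x : ℝ) : EReal).abs = _
    rw [EReal.abs_def, NNReal.abs_eq, ENNReal.ofReal_coe_nnreal]

theorem IsNonatomic.exists_rearrangement_rpow_eq_stepSum {μ : Measure R} [IsFiniteMeasure μ]
    (h : IsNonatomic μ) {p : ℝ} (hp : 0 < p) {c : ℕ → ℝ≥0∞} (hc : ∀ k, c k ≠ ∞) {m : ℕ → ℝ}
    (hm : Antitone m) (hm0 : Filter.Tendsto m Filter.atTop (nhds 0)) (hle : m 0 ≤ μ.real univ) :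
    ∃ u : R → EReal, Measurable u ∧ (∀ᵐ x ∂μ, (u x).abs < ∞) ∧
      ∀ t, 0 < t → rearrangement μ (fun x => (u x).abs) t ^ p = stepSum c m t := by
  obtain ⟨A, hA, hAmeas, hAm⟩ := h.exists_antitone_seq hm (fun k => hm.le_of_tendsto hm0 k) hle
  let F : R → ℝ≥0∞ := fun x => ∑' k, (A k).indicator (fun _ => c k) x
  have hF : Measurable F := Measurable.tsum fun k => measurable_const.indicator (hAmeas k)
  refine ⟨fun x => ((F x ^ (1 / p) : ℝ≥0∞) : EReal),
    measurable_coe_ennreal_ereal.comp (hF.pow_const _), ?_, fun t ht => ?_⟩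
  -- Outside A n the series is a finite sum of finite terms, so F is infinite only on the
  -- intersection of the A n, a null set.
  · have hsub : ∀ n, {x | ¬ F x < ∞} ⊆ A n := fun n x hx => by
      by_contra hxA
      refine hx ?_
      have : F x = ∑ k ∈ Finset.range n, (A k).indicator (fun _ => c k) x :=
        tsum_eq_sum fun k hk => indicator_of_notMem
          (fun hxk => hxA (hA (by simpa using hk) hxk)) _
      rw [this]
      refine ENNReal.sum_lt_top.2 fun k _ => ?_
      have h1 : (A k).indicator (fun _ => c k) x ≤ c k :=
        indicator_le_self' (fun _ _ => zero_le) x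
      exact h1.trans_lt (hc k).lt_top
    have hnull : μ {x | ¬ F x < ∞} = 0 := by
      have hlim : Filter.Tendsto (fun n => ENNReal.ofReal (m n)) Filter.atTop (nhds 0) := by
        simpa using ENNReal.tendsto_ofReal hm0
      refine le_antisymm (ge_of_tendsto' hlim fun n => ?_) zero_le
      rw [← hAm, ofReal_measureReal]
      exact measure_mono (hsub n)
    filter_upwards [show ∀ᵐ x ∂μ, F x < ∞ from hnull] with x hx
    rw [abs_coe_ennreal]
    exact ENNReal.rpow_lt_top_of_nonneg (by positivity) hx.ne
  · simp only [abs_coe_ennreal]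
    exact rearrangement_rpow_one_div hp (measure_stepSum_lt_le c hm0 hA hAm ht)
      fun l hl => stepSum_le_of_measure_le hA hAm ht hl

/-! ### The test functions: nodes and jumps -/

/-- The points at which the logarithmic weight takes the values `4 ^ k`. -/
noncomputable def node (M : ℝ) (k : ℕ) : ℝ := M * Real.exp (1 - 4 ^ k)

theorem node_pos {M : ℝ} (hM : 0 < M) (k : ℕ) : 0 < node M k := by unfold node; positivity

theorem node_zero (M : ℝ) : node M 0 = M := by simp [node]

theorem node_antitone {M : ℝ} (hM : 0 < M) : Antitone (node M) := fun i j h => by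
  unfold node
  gcongr
  norm_num

theorem tendsto_node (M : ℝ) : Filter.Tendsto (node M) Filter.atTop (nhds 0) := by
  have h : Filter.Tendsto (fun k : ℕ => (1 : ℝ) - 4 ^ k) Filter.atTop Filter.atBot :=
    Filter.tendsto_atBot_add_const_left _ 1
      (Filter.tendsto_neg_atTop_atBot.comp (tendsto_pow_atTop_atTop_of_one_lt (by norm_num)))
  have h2 := (Real.tendsto_exp_atBot.comp h).const_mul M
  rwa [mul_zero] at h2

theorem node_le {M : ℝ} (hM : 0 < M) (k : ℕ) : node M k ≤ M :=
  (node_antitone hM (Nat.zero_le k)).trans_eq (node_zero M)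

theorem logWeight_node {M : ℝ} (hM : 0 < M) (k : ℕ) : logWeight M (node M k) = 4 ^ k := by
  rw [logWeight_eq hM (node_pos hM k), node, Real.log_mul hM.ne' (Real.exp_ne_zero _),
    Real.log_exp]
  ring

theorem Ioo_eq_iUnion_Ico_node {M : ℝ} (hM : 0 < M) :
    Ioo 0 M = ⋃ j, Ico (node M (j + 1)) (node M j) := by
  classical
  ext x
  simp only [mem_Ioo, mem_iUnion, mem_Ico]
  constructor
  · rintro ⟨h0, h1⟩
    have hex : ∃ n, node M n ≤ x :=
      (((tendsto_node M).eventually (gt_mem_nhds h0)).mono fun _ h => le_of_lt h).exists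
    obtain ⟨j, hj⟩ : ∃ j, Nat.find hex = j + 1 := Nat.exists_eq_succ_of_ne_zero fun h => by
      have := Nat.find_spec hex
      rw [h, node_zero] at this
      exact h1.not_ge this
    exact ⟨j, hj ▸ Nat.find_spec hex, not_le.1 (Nat.find_min hex (by omega))⟩
  · rintro ⟨j, h0, h1⟩
    exact ⟨(node_pos hM _).trans_le h0, h1.trans_le (node_le hM j)⟩

theorem lintegral_Ioo_eq_tsum_node {M : ℝ} (hM : 0 < M) (φ : ℝ → ℝ≥0∞) :
    ∫⁻ t in Ioo 0 M, φ t = ∑' j, ∫⁻ t in Ico (node M (j + 1)) (node M j), φ t := by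
  rw [Ioo_eq_iUnion_Ico_node hM, lintegral_iUnion (fun _ => measurableSet_Ico)]
  exact (node_antitone hM).pairwise_disjoint_on_Ico_succ

theorem lintegral_inv_node {M : ℝ} (hM : 0 < M) (j : ℕ) :
    ∫⁻ t in Ico (node M (j + 1)) (node M j), (ENNReal.ofReal t)⁻¹ =
      ENNReal.ofReal (3 * 4 ^ j) := by
  have h := lintegral_logWeight_rpow (b := 1) (node_pos hM (j + 1))
    (node_antitone hM j.le_succ) (node_le hM j) one_ne_zero
  rw [logWeight_node hM, logWeight_node hM, Real.rpow_one, Real.rpow_one, div_one,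
    show (4 : ℝ) ^ (j + 1) - 4 ^ j = 3 * 4 ^ j by ring, restrict_Ioo_eq_restrict_Ico] at h
  rw [← h]
  refine setLIntegral_congr_fun measurableSet_Ico fun t ht => ?_
  have ht0 := (node_pos hM _).trans_le ht.1
  simp [ENNReal.ofReal_inv_of_pos ht0]

/-- The jumps `a k * 4 ^ (-k / r) / node M k`. -/
noncomputable def jump (M r : ℝ) (a : ℕ → ℝ) (k : ℕ) : ℝ :=
  a k * ((4 : ℝ) ^ (-(1 / r))) ^ k / node M k

theorem quarter_le {r : ℝ} (hr : 1 < r) : (1 / 4 : ℝ) ≤ 4 ^ (-(1 / r)) := by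
  have h : (4 : ℝ) ^ (-1 : ℝ) ≤ 4 ^ (-(1 / r)) := by
    refine Real.rpow_le_rpow_of_exponent_le (by norm_num) (neg_le_neg ?_)
    exact (div_le_one (by linarith)).2 hr.le
  rwa [Real.rpow_neg_one, ← one_div] at h

theorem sixteen_le_exp_three : (16 : ℝ) ≤ Real.exp 3 := by
  have h := Real.exp_one_gt_d9
  have h2 : Real.exp 3 = Real.exp 1 ^ 3 := by rw [← Real.exp_nat_mul]; norm_num
  rw [h2]
  calc (16 : ℝ) ≤ 2.7 ^ 3 := by norm_num
    _ ≤ _ := by gcongr; linarith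

/-- Consecutive nodes shrink at least by the factor 16, a loses at most a factor 2, and 4^(-1/r) ≥
1/4; the net growth is at least 16/(2·4) = 2. -/
theorem two_mul_jump_le {M r : ℝ} (hM : 0 < M) (hr : 1 < r) {a : ℕ → ℝ} (ha : ∀ k, 0 < a k)
    (ha2 : ∀ k, a k ≤ 2 * a (k + 1)) (k : ℕ) : 2 * jump M r a k ≤ jump M r a (k + 1) := by
  have hθ := quarter_le hr
  unfold jump
  set θ : ℝ := (4 : ℝ) ^ (-(1 / r))
  have hθ0 : 0 < θ := by linarith
  have hn := node_pos hM k
  have hn' := node_pos hM (k + 1)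
  have hnode : 16 * node M (k + 1) ≤ node M k := by
    have h1 : node M k = Real.exp (3 * 4 ^ k) * node M (k + 1) := by
      rw [node, node, mul_left_comm, ← Real.exp_add]
      congr 2
      ring
    rw [h1]
    gcongr
    refine sixteen_le_exp_three.trans (Real.exp_le_exp.2 ?_)
    linarith [one_le_pow₀ (M₀ := ℝ) (a := 4) (by norm_num) (n := k)]
  rw [← mul_div_assoc, div_le_div_iff₀ hn hn', pow_succ]
  have hp : 0 < θ ^ k := by positivity
  calc 2 * (a k * θ ^ k) * node M (k + 1)
      ≤ 2 * (2 * a (k + 1) * θ ^ k) * (node M k / 16) := by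
        have := ha (k + 1)
        gcongr
        · exact ha2 k
        · linarith
    _ = a (k + 1) * (θ ^ k * (1 / 4)) * node M k := by ring
    _ ≤ a (k + 1) * (θ ^ k * θ) * node M k := by
        have := ha (k + 1)
        gcongr

theorem jump_pos {M : ℝ} (hM : 0 < M) (r : ℝ) {a : ℕ → ℝ} (ha : ∀ k, 0 < a k) (k : ℕ) :
    0 < jump M r a k :=
  div_pos (mul_pos (ha k) (by positivity)) (node_pos hM k)

theorem sum_jump_le {M r : ℝ} (hM : 0 < M) (hr : 1 < r) {a : ℕ → ℝ} (ha : ∀ k, 0 < a k)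
    (ha2 : ∀ k, a k ≤ 2 * a (k + 1)) (n : ℕ) :
    ∑ k ∈ Finset.range n, jump M r a k ≤ jump M r a n := by
  induction n with
  | zero => simpa using (jump_pos hM r ha 0).le
  | succ n ih =>
    rw [Finset.sum_range_succ]
    linarith [two_mul_jump_le hM hr ha ha2 n]

theorem jump_mul_node {M : ℝ} (hM : 0 < M) (r : ℝ) (a : ℕ → ℝ) (k : ℕ) :
    jump M r a k * node M k = a k * ((4 : ℝ) ^ (-(1 / r))) ^ k :=
  div_mul_cancel₀ _ (node_pos hM k).ne'

/-- The step function with jumps `jump M r a k` at `node M k`. -/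
noncomputable def nodeStep (M r : ℝ) (a : ℕ → ℝ) : ℝ → ℝ≥0∞ :=
  stepSum (fun k => ENNReal.ofReal (jump M r a k)) (node M)

theorem lintegral_mul_stepSum {c : ℕ → ℝ≥0∞} {m : ℕ → ℝ} {w : ℝ → ℝ≥0∞} (hw : Measurable w)
    (x : ℝ) : ∫⁻ s in Ioo 0 x, w s * stepSum c m s =
      ∑' k, (∫⁻ s in Ioo 0 (min x (m k)), w s) * c k := by
  simp only [stepSum, ← ENNReal.tsum_mul_left]
  have hm : ∀ k, Measurable fun s => w s * (Iio (m k)).indicator (fun _ => c k) s := fun k =>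
    hw.mul (measurable_const.indicator measurableSet_Iio)
  rw [lintegral_tsum fun k => (hm k).aemeasurable]
  refine tsum_congr fun k => ?_
  rw [← Ioo_inter_Iio, inter_comm, ← Measure.restrict_restrict measurableSet_Iio,
    ← lintegral_mul_const _ hw, ← lintegral_indicator measurableSet_Iio]
  refine lintegral_congr fun s => ?_
  by_cases hs : s ∈ Iio (m k)
  · simp only [indicator_of_mem hs]
  · simp only [indicator_of_notMem hs, mul_zero]

theorem lintegral_stepSum {c : ℕ → ℝ≥0∞} {m : ℕ → ℝ} (x : ℝ) :
    ∫⁻ s in Ioo 0 x, stepSum c m s = ∑' k, ENNReal.ofReal (min x (m k)) * c k := by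
  simpa using lintegral_mul_stepSum (c := c) (m := m) (w := fun _ => 1) measurable_const x

theorem le_lintegral_nodeStep {M : ℝ} (hM : 0 < M) (r : ℝ) (a : ℕ → ℝ) (j : ℕ) :
    ENNReal.ofReal (a j * ((4 : ℝ) ^ (-(1 / r))) ^ j) ≤
      ∫⁻ s in Ioo 0 (node M j), nodeStep M r a s := by
  rw [nodeStep, lintegral_stepSum]
  refine le_trans (le_of_eq ?_) (ENNReal.le_tsum j)
  rw [min_self, ← ENNReal.ofReal_mul (node_pos hM j).le, ← jump_mul_node hM, mul_comm]

/-- The jumps before j sum to at most the jth one, which gives the 1 in K; the terms from j on are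
dominated by a geometric series of ratio 4^(-1/r), because a is non-increasing. -/
theorem exists_lintegral_nodeStep_le {M r : ℝ} (hM : 0 < M) (hr : 1 < r) {a : ℕ → ℝ}
    (ha : ∀ k, 0 < a k) (ha1 : Antitone a) (ha2 : ∀ k, a k ≤ 2 * a (k + 1)) :
    ∃ K : ℝ, 0 < K ∧ ∀ j, ∫⁻ s in Ioo 0 (node M j), nodeStep M r a s ≤
      ENNReal.ofReal (K * (a j * ((4 : ℝ) ^ (-(1 / r))) ^ j)) := by
  have hmul := jump_mul_node hM r a
  have hθ0 : 0 < (4 : ℝ) ^ (-(1 / r)) := by positivity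
  have hθ1 : (4 : ℝ) ^ (-(1 / r)) < 1 :=
    Real.rpow_lt_one_of_one_lt_of_neg (by norm_num) (neg_neg_of_pos (by positivity))
  set θ : ℝ := (4 : ℝ) ^ (-(1 / r))
  have h1θ : 0 < 1 - θ := sub_pos.2 hθ1
  refine ⟨1 + (1 - θ)⁻¹, by positivity, fun j => ?_⟩
  have hb : 0 < a j * θ ^ j := mul_pos (ha j) (by positivity)
  rw [nodeStep, lintegral_stepSum, add_mul, one_mul, ENNReal.ofReal_add hb.le (by positivity),
    ← ENNReal.summable.sum_add_tsum_nat_add' (k := j)]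
  gcongr ?_ + ?_
  · calc ∑ k ∈ Finset.range j, ENNReal.ofReal (min (node M j) (node M k)) *
          ENNReal.ofReal (jump M r a k)
        ≤ ∑ k ∈ Finset.range j, ENNReal.ofReal (node M j * jump M r a k) := by
          refine Finset.sum_le_sum fun k _ => ?_
          rw [ENNReal.ofReal_mul (node_pos hM j).le]
          gcongr
          exact min_le_left _ _
      _ = ENNReal.ofReal (node M j * ∑ k ∈ Finset.range j, jump M r a k) := by
          rw [Finset.mul_sum, ENNReal.ofReal_sum_of_nonneg]
          exact fun k _ => (mul_pos (node_pos hM j) (jump_pos hM r ha k)).le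
      _ ≤ ENNReal.ofReal (a j * θ ^ j) := by
          rw [← hmul j, mul_comm]
          have := node_pos hM j
          gcongr
          exact sum_jump_le hM hr ha ha2 j
  · calc ∑' k, ENNReal.ofReal (min (node M j) (node M (k + j))) *
          ENNReal.ofReal (jump M r a (k + j))
        ≤ ∑' k, ENNReal.ofReal (a j * θ ^ j * θ ^ k) := by
          refine ENNReal.tsum_le_tsum fun k => ?_
          rw [← ENNReal.ofReal_mul (le_min (node_pos hM _).le (node_pos hM _).le)]
          apply ENNReal.ofReal_le_ofReal
          calc min (node M j) (node M (k + j)) * jump M r a (k + j)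
              ≤ node M (k + j) * jump M r a (k + j) := by
                have := jump_pos hM r ha (k + j)
                gcongr
                exact min_le_right _ _
            _ = a (k + j) * θ ^ (k + j) := by rw [mul_comm, hmul]
            _ ≤ a j * θ ^ (k + j) := by
                gcongr
                exact ha1 (Nat.le_add_left j k)
            _ = a j * θ ^ j * θ ^ k := by ring
      _ = ENNReal.ofReal ((1 - θ)⁻¹ * (a j * θ ^ j)) := by
          rw [← ENNReal.ofReal_tsum_of_nonneg (fun k => by positivity)
            ((summable_geometric_of_lt_one hθ0.le hθ1).mul_left _), tsum_mul_left,
            tsum_geometric_of_lt_one hθ0.le hθ1, mul_comm]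

/-! ### The functionals on the test functions -/

theorem four_rpow_pow_rpow {r : ℝ} (hr : 0 < r) (j : ℕ) :
    (((4 : ℝ) ^ (-(1 / r))) ^ j) ^ r * 4 ^ j = 1 := by
  have h4 : (0 : ℝ) ≤ 4 := by norm_num
  rw [← Real.rpow_natCast, ← Real.rpow_natCast, ← Real.rpow_mul h4, ← Real.rpow_mul h4,
    ← Real.rpow_add (by norm_num), show -(1 / r) * j * r + j = 0 by field_simp; ring, Real.rpow_zero]

theorem lintegral_Ico_node_const_div {M : ℝ} (hM : 0 < M) (j : ℕ) (x : ℝ≥0∞) :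
    ∫⁻ t in Ico (node M (j + 1)) (node M j), x / ENNReal.ofReal t =
      x * ENNReal.ofReal (3 * 4 ^ j) := by
  simp only [div_eq_mul_inv]
  rw [lintegral_const_mul _ (by fun_prop), lintegral_inv_node hM]

/-- On the jth block G^r is at most K^r a_j^r 4^(-j), which cancels the growth of the dt/t-mass
3·4^j. -/
theorem lintegral_rpow_nodeStep_lt_top {M r : ℝ} (hM : 0 < M) (hr : 1 < r) {a : ℕ → ℝ}
    (ha : ∀ k, 0 < a k) (ha1 : Antitone a) (ha2 : ∀ k, a k ≤ 2 * a (k + 1))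
    (hsum : Summable fun k => a k ^ r) :
    ∫⁻ t in Ioo 0 M, (∫⁻ s in Ioo 0 t, nodeStep M r a s) ^ r / ENNReal.ofReal t < ∞ := by
  have hr0 : 0 < r := one_pos.trans hr
  obtain ⟨K, hK, hle⟩ := exists_lintegral_nodeStep_le hM hr ha ha1 ha2
  have hnn : ∀ k, 0 ≤ a k ^ r := fun k => Real.rpow_nonneg (ha k).le r
  rw [lintegral_Ioo_eq_tsum_node hM]
  calc ∑' j, ∫⁻ t in Ico (node M (j + 1)) (node M j),
        (∫⁻ s in Ioo 0 t, nodeStep M r a s) ^ r / ENNReal.ofReal t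
      ≤ ∑' j, ENNReal.ofReal (3 * K ^ r * a j ^ r) := by
        refine ENNReal.tsum_le_tsum fun j => ?_
        have hb : 0 ≤ a j * ((4 : ℝ) ^ (-(1 / r))) ^ j := mul_nonneg (ha j).le (by positivity)
        refine (setLIntegral_mono' measurableSet_Ico fun t ht => ENNReal.div_le_div_right
          (ENNReal.rpow_le_rpow ((lintegral_mono_set (Ioo_subset_Ioo_right ht.2.le)).trans
            (hle j)) hr0.le) _).trans_eq ?_
        rw [lintegral_Ico_node_const_div hM,
          ENNReal.ofReal_rpow_of_nonneg (by positivity) hr0.le,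
          ← ENNReal.ofReal_mul (by positivity), Real.mul_rpow hK.le hb,
          Real.mul_rpow (ha j).le (by positivity)]
        congr 1
        linear_combination 3 * K ^ r * a j ^ r * four_rpow_pow_rpow hr0 j
    _ < ∞ := by
        rw [← ENNReal.ofReal_tsum_of_nonneg (fun k => mul_nonneg (by positivity) (hnn k))
          (hsum.mul_left _)]
        exact ENNReal.ofReal_lt_top

theorem lintegral_rpow_nodeStep_eq_top {M r : ℝ} (hM : 0 < M) (hr : 1 < r) :
    ∫⁻ t in Ioo 0 M, (∫⁻ s in Ioo 0 t, nodeStep M r (fun _ => 1) s) ^ r / ENNReal.ofReal t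
      = ∞ := by
  have hr0 : 0 < r := one_pos.trans hr
  rw [lintegral_Ioo_eq_tsum_node hM, eq_top_iff,
    -- G is bounded below on a block by its value at the left endpoint, of index j + 1, so each
    -- block contributes at least 4^(-(j+1))·3·4^j = 3/4.
    ← ENNReal.tsum_const_eq_top_of_ne_zero (α := ℕ) (c := ENNReal.ofReal (3 / 4)) (by norm_num)]
  refine ENNReal.tsum_le_tsum fun j => ?_
  refine le_trans (le_of_eq ?_) (setLIntegral_mono' measurableSet_Ico fun t ht =>
    ENNReal.div_le_div_right (ENNReal.rpow_le_rpow ((le_lintegral_nodeStep hM r _ (j + 1)).trans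
      (lintegral_mono_set (Ioo_subset_Ioo_right ht.1))) hr0.le) _)
  rw [lintegral_Ico_node_const_div hM, ENNReal.ofReal_rpow_of_nonneg (by positivity) hr0.le,
    ← ENNReal.ofReal_mul (by positivity), one_mul]
  congr 1
  have h := four_rpow_pow_rpow hr0 (j + 1)
  rw [pow_succ (4 : ℝ)] at h
  linarith

/-- The kth step lives where L ≥ 4^k, so it alone contributes at least 4^(k/r) times its mass a_k
4^(-k/r). -/
theorem le_lintegral_logWeight_mul_nodeStep {M r : ℝ} (hM : 0 < M) (hr : 1 < r) {a : ℕ → ℝ} :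
    ∑' k, ENNReal.ofReal (a k) ≤
      ∫⁻ s in Ioo 0 M, ENNReal.ofReal (logWeight M s ^ (1 / r)) * nodeStep M r a s := by
  have hr0 : 0 < r := one_pos.trans hr
  rw [nodeStep, lintegral_mul_stepSum (by fun_prop)]
  refine ENNReal.tsum_le_tsum fun k => ?_
  have hn := node_pos hM k
  rw [min_eq_right (node_le hM k)]
  calc ENNReal.ofReal (a k)
      = (∫⁻ _ in Ioo 0 (node M k), ENNReal.ofReal (((4 : ℝ) ^ k) ^ (1 / r))) *
        ENNReal.ofReal (jump M r a k) := by
        rw [setLIntegral_const, Real.volume_Ioo, sub_zero, ← ENNReal.ofReal_mul (by positivity),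
          ← ENNReal.ofReal_mul (by positivity), mul_assoc, mul_comm (node M k),
          jump_mul_node hM, mul_left_comm, ← Real.rpow_natCast, ← Real.rpow_natCast,
          ← Real.rpow_mul (by norm_num), ← Real.rpow_mul (by norm_num),
          ← Real.rpow_add (by norm_num), show (k : ℝ) * (1 / r) + -(1 / r) * k = 0 by ring,
          Real.rpow_zero, mul_one]
    _ ≤ _ := by
        gcongr ?_ * _
        refine setLIntegral_mono' measurableSet_Ioo fun s hs => ?_
        gcongr
        rw [← logWeight_node hM]
        exact logWeight_anti hM hs.1 hs.2.le

/-- After Fubini the jth block contributes at most a multiple of 4^(j(β-1)) · 4^(-j/r) · 4^j, a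
geometric series of ratio 4^(β-1/r) < 1. -/
theorem lintegral_logWeight_mul_nodeStep_lt_top {M r β : ℝ} (hM : 0 < M) (hr : 1 < r)
    (hβ : 0 < β) (hβr : β < 1 / r) :
    ∫⁻ s in Ioo 0 M, ENNReal.ofReal (logWeight M s ^ β) * nodeStep M r (fun _ => 1) s < ∞ := by
  have hr0 : 0 < r := one_pos.trans hr
  have hβ1 : β < 1 := hβr.trans ((div_lt_one hr0).2 hr)
  obtain ⟨K, hK, hle⟩ := exists_lintegral_nodeStep_le hM hr (a := fun _ => 1)
    (fun _ => one_pos) antitone_const (fun _ => by norm_num)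
  simp only [one_mul] at hle
  rw [lintegral_logWeight_rpow_mul_eq hM hβ (g := nodeStep M r fun _ => 1)
    (measurable_stepSum _ _)]
  refine ENNReal.add_lt_top.2 ⟨?_, ENNReal.mul_lt_top ENNReal.ofReal_lt_top ?_⟩
  · have h := hle 0
    rw [node_zero] at h
    exact h.trans_lt ENNReal.ofReal_lt_top
  rw [lintegral_Ioo_eq_tsum_node hM]
  calc ∑' j, ∫⁻ t in Ico (node M (j + 1)) (node M j),
        ENNReal.ofReal (logWeight M t ^ (β - 1) / t) *
          ∫⁻ s in Ioo 0 t, nodeStep M r (fun _ => 1) s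
      ≤ ∑' j, ENNReal.ofReal (3 * K * ((4 : ℝ) ^ (β - 1 / r)) ^ j) := by
        refine ENNReal.tsum_le_tsum fun j => ?_
        calc ∫⁻ t in Ico (node M (j + 1)) (node M j),
              ENNReal.ofReal (logWeight M t ^ (β - 1) / t) *
                ∫⁻ s in Ioo 0 t, nodeStep M r (fun _ => 1) s
            ≤ ∫⁻ t in Ico (node M (j + 1)) (node M j),
              ENNReal.ofReal (((4 : ℝ) ^ j) ^ (β - 1)) *
                ENNReal.ofReal (K * ((4 : ℝ) ^ (-(1 / r))) ^ j) / ENNReal.ofReal t := by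
              refine setLIntegral_mono' measurableSet_Ico fun t ht => ?_
              have ht0 := (node_pos hM _).trans_le ht.1
              rw [ENNReal.ofReal_div_of_pos ht0, ENNReal.mul_div_right_comm]
              refine mul_le_mul' (ENNReal.div_le_div_right (ENNReal.ofReal_le_ofReal ?_) _) ?_
              · refine Real.rpow_le_rpow_of_nonpos (by positivity) ?_ (by linarith)
                rw [← logWeight_node hM]
                exact logWeight_anti hM ht0 ht.2.le
              · exact (lintegral_mono_set (Ioo_subset_Ioo_right ht.2.le)).trans (hle j)
          _ = ENNReal.ofReal (3 * K * ((4 : ℝ) ^ (β - 1 / r)) ^ j) := by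
              rw [lintegral_Ico_node_const_div hM, ← ENNReal.ofReal_mul (by positivity),
                ← ENNReal.ofReal_mul (by positivity)]
              congr 1
              have h : ((4 : ℝ) ^ j) ^ (β - 1) * (((4 : ℝ) ^ (-(1 / r))) ^ j) * 4 ^ j =
                  ((4 : ℝ) ^ (β - 1 / r)) ^ j := by
                simp only [← Real.rpow_natCast]
                rw [← Real.rpow_mul (by norm_num), ← Real.rpow_mul (by norm_num),
                  ← Real.rpow_mul (by norm_num), ← Real.rpow_add (by norm_num),
                  ← Real.rpow_add (by norm_num)]
                congr 1
                ring
              linear_combination 3 * K * h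
    _ < ∞ := by
        rw [← ENNReal.ofReal_tsum_of_nonneg (fun k => by positivity)]
        · exact ENNReal.ofReal_lt_top
        · exact (summable_geometric_of_lt_one (by positivity)
            (Real.rpow_lt_one_of_one_lt_of_neg (by norm_num) (by linarith))).mul_left _

/-! ### Strictness of the inclusions -/

theorem tsum_ofReal_one_div_add_one_eq_top :
    ∑' k : ℕ, ENNReal.ofReal (1 / ((k : ℝ) + 1)) = ∞ := by
  by_contra h
  have hs := ENNReal.summable_toReal h
  have hs' : Summable fun k : ℕ => 1 / (((k + 1 : ℕ) : ℝ)) := by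
    refine hs.congr fun k => ?_
    rw [ENNReal.toReal_ofReal (by positivity)]
    push_cast
    rfl
  exact Real.not_summable_one_div_natCast ((summable_nat_add_iff 1).1 hs')

theorem IsNonatomic.exists_rearrangement_rpow_eq_nodeStep {μ : Measure R} [IsFiniteMeasure μ]
    (h : IsNonatomic μ) (hM : 0 < μ.real univ) {p : ℝ} (hp : 0 < p) (r : ℝ) (a : ℕ → ℝ) :
    ∃ u : R → EReal, Measurable u ∧ (∀ᵐ x ∂μ, (u x).abs < ∞) ∧
      ∀ t, 0 < t → rearrangement μ (fun x => (u x).abs) t ^ p =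
        nodeStep (μ.real univ) r a t :=
  h.exists_rearrangement_rpow_eq_stepSum hp (fun _ => ENNReal.ofReal_ne_top)
    (node_antitone hM) (tendsto_node _) (node_zero _).le

theorem lorentzZygmund_self_of_rearrangement_eq {μ : Measure R} {p : ℝ} (hp : 0 < p) (a : ℝ)
    {f : R → ℝ≥0∞} {g : ℝ → ℝ≥0∞} (h : ∀ t, 0 < t → rearrangement μ f t ^ p = g t) :
    lorentzZygmund μ p p a f = (∫⁻ s in Ioo 0 (μ.real univ),
      ENNReal.ofReal (logWeight (μ.real univ) s ^ (a * p)) * g s) ^ (1 / p) := by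
  rw [lorentzZygmund_self_eq μ hp]
  congr 1
  exact setLIntegral_congr_fun measurableSet_Ioo fun s hs => by simp only [h s hs.1]

theorem yNorm_of_rearrangement_eq {μ : Measure R} {p : ℝ} (q : ℝ) {f : R → ℝ≥0∞}
    {g : ℝ → ℝ≥0∞} (h : ∀ t, 0 < t → rearrangement μ f t ^ p = g t) :
    yNorm μ p q f = (∫⁻ t in Ioo 0 (μ.real univ),
      (∫⁻ s in Ioo 0 t, g s) ^ (q / p) / ENNReal.ofReal t) ^ (1 / q) := by
  rw [yNorm]
  congr 2
  ext t
  rw [setLIntegral_congr_fun measurableSet_Ioo fun s (hs : s ∈ Ioo 0 t) => h s hs.1]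

theorem not_space_yNorm_subset {μ : Measure R} [IsFiniteMeasure μ] (h : IsNonatomic μ)
    (hM : 0 < μ.real univ) {p q : ℝ} (hp : 0 < p) (hpq : p < q) :
    ¬ space μ (yNorm μ p q) ⊆ space μ (lorentzZygmund μ p p (1 / q)) := by
  intro hsub
  have hq : 0 < q := hp.trans hpq
  have hr : 1 < q / p := (one_lt_div hp).2 hpq
  -- In ℓ^r for every r > 1 but not in ℓ^1, and decaying slowly enough for the jumps to double.
  let a : ℕ → ℝ := fun k => 1 / ((k : ℝ) + 1)
  obtain ⟨u, hu, hfin, hre⟩ := h.exists_rearrangement_rpow_eq_nodeStep hM hp (q / p) a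
  have hY : yNorm μ p q (fun x => (u x).abs) < ∞ := by
    rw [yNorm_of_rearrangement_eq q hre]
    refine ENNReal.rpow_lt_top_of_nonneg (by positivity)
      (lintegral_rpow_nodeStep_lt_top hM hr (fun k => by positivity) (fun i j hij => ?_)
        (fun k => ?_) ?_).ne
    · simp only [a]
      gcongr
    · simp only [a]
      push_cast
      rw [mul_one_div, div_le_div_iff₀ (by positivity) (by positivity)]
      linarith [k.cast_nonneg (α := ℝ)]
    · refine ((summable_nat_add_iff 1).2 (Real.summable_one_div_nat_rpow.2 hr)).congr fun k => ?_
      simp only [a]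
      push_cast
      rw [Real.div_rpow zero_le_one (by positivity), Real.one_rpow]
  have hZ := (hsub ⟨hu, hfin, hY⟩).2.2
  rw [lorentzZygmund_self_of_rearrangement_eq hp _ hre, one_div_mul_eq_div, ← one_div_div] at hZ
  have htop : ∫⁻ s in Ioo 0 (μ.real univ), ENNReal.ofReal (logWeight (μ.real univ) s ^
      (1 / (q / p))) * nodeStep (μ.real univ) (q / p) a s = ∞ :=
    eq_top_iff.2 (tsum_ofReal_one_div_add_one_eq_top.symm.le.trans
      (le_lintegral_logWeight_mul_nodeStep hM hr))
  rw [htop, ENNReal.top_rpow_of_pos (by positivity)] at hZ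
  exact lt_irrefl _ hZ

theorem not_space_lorentzZygmund_subset {μ : Measure R} [IsFiniteMeasure μ] (h : IsNonatomic μ)
    (hM : 0 < μ.real univ) {p q α : ℝ} (hp : 0 < p) (hpq : p < q) (hα : 0 < α)
    (hαq : α < 1 / q) :
    ¬ space μ (lorentzZygmund μ p p α) ⊆ space μ (yNorm μ p q) := by
  intro hsub
  have hq : 0 < q := hp.trans hpq
  have hr : 1 < q / p := (one_lt_div hp).2 hpq
  have hβ : α * p < 1 / (q / p) := by
    rw [one_div_div, ← one_div_mul_eq_div]
    gcongr
  -- The constant sequence is not in ℓ^r, yet the strict gap αp < 1/r keeps the logarithmic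
  -- functional finite.
  obtain ⟨u, hu, hfin, hre⟩ :=
    h.exists_rearrangement_rpow_eq_nodeStep hM hp (q / p) fun _ => 1
  have hZ : lorentzZygmund μ p p α (fun x => (u x).abs) < ∞ := by
    rw [lorentzZygmund_self_of_rearrangement_eq hp _ hre]
    exact ENNReal.rpow_lt_top_of_nonneg (by positivity)
      (lintegral_logWeight_mul_nodeStep_lt_top hM hr (mul_pos hα hp) hβ).ne
  have hY := (hsub ⟨hu, hfin, hZ⟩).2.2
  rw [yNorm_of_rearrangement_eq q hre, lintegral_rpow_nodeStep_eq_top hM hr,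
    ENNReal.top_rpow_of_pos (by positivity)] at hY
  exact lt_irrefl _ hY

end LorentzBridge

theorem mainTheorem2 {R : Type*} [MeasurableSpace R] (μ : MeasureTheory.Measure R)
    [MeasureTheory.IsFiniteMeasure μ] (hμ : μ ≠ 0) (hna : LorentzBridge.IsNonatomic μ)
    (p q α : ℝ) (hp : 1 ≤ p) (hpq : p < q) (hα : 0 < α) (hαq : α < 1 / q) :
    -- the two embeddings
    LorentzBridge.Embeds μ (LorentzBridge.lorentzZygmund μ p p (1 / q))
        (LorentzBridge.yNorm μ p q) ∧
    LorentzBridge.Embeds μ (LorentzBridge.yNorm μ p q)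
        (LorentzBridge.lorentzZygmund μ p p α) ∧
    -- neither can be reversed
    ¬ LorentzBridge.Embeds μ (LorentzBridge.yNorm μ p q)
        (LorentzBridge.lorentzZygmund μ p p (1 / q)) ∧
    ¬ LorentzBridge.Embeds μ (LorentzBridge.lorentzZygmund μ p p α)
        (LorentzBridge.yNorm μ p q) ∧
    -- the inclusions are strict already as inclusions of sets
    LorentzBridge.space μ (LorentzBridge.lorentzZygmund μ p p (1 / q)) ⊂
        LorentzBridge.space μ (LorentzBridge.yNorm μ p q) ∧
    LorentzBridge.space μ (LorentzBridge.yNorm μ p q) ⊂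
        LorentzBridge.space μ (LorentzBridge.lorentzZygmund μ p p α) := by
  have hp0 : 0 < p := one_pos.trans_le hp
  have hM : 0 < μ.real univ := by
    have : NeZero μ := ⟨hμ⟩
    exact measureReal_univ_pos
  have h1 := LorentzBridge.embeds_lorentzZygmund_yNorm μ hM hp0 hpq
  have h2 := LorentzBridge.embeds_yNorm_lorentzZygmund μ hM hp0 hpq hα hαq
  have h3 := LorentzBridge.not_space_yNorm_subset hna hM hp0 hpq
  have h4 := LorentzBridge.not_space_lorentzZygmund_subset hna hM hp0 hpq hα hαq
  exact ⟨h1, h2, fun h => h3 h.1, fun h => h4 h.1, ⟨h1.1, h3⟩, ⟨h2.1, h4⟩⟩
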